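/- By a real algebra we mean a real vector space $A$ with a bilinear product, not assumed associative or unital; $(x,y,z)=(xy)z-x(yz)$ is the associator. A nonzero real algebra $A$ is absolute-valued if it carries a vector-space norm with $\|xy\|=\|x\|\,\|y\|$ for all $x,y\in A$. The degree of a finite-dimensional algebra is the smallest natural number $n$ such that every subalgebra generated by one element has dimension at most $n$. Let $\mathbb H$ be the algebra of real quaternions, let ${}^*\mathbb H$ be the vector space $\mathbb H$ with the product $x\odot y=\bar x y$, and, for norm-one $a,b\in\mathbb H$, let ${}^*\mathbb H(a,b)$ be the vector space $\mathbb H$ with the product $x\odot y=\bar x a y b$; in particular ${}^*\mathbb H(i,1)$ has product $x\odot y=\bar x i y$. **Theorem 4.** Let $A$ be a four-dimensional absolute-valued real algebra with a left unit (an element $e$ with $ex=x$ for all $x\in A$) such that $(x^2,x^2,x^2)=0$ for all $x\in A$. Then $A$ is isomorphic, as an algebra, to $\mathbb H$, ${}^*\mathbb H$ or ${}^*\mathbb H(i,1)$. Moreover ${}^*\mathbb H(i,1)$ has degree $4$, while $\mathbb H$ and ${}^*\mathbb H$ have degree $2$. -/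

import Mathlib

open scoped Quaternion

/-- A (not necessarily associative or unital) real algebra is absolute-valued if it is nonzero and
carries a vector-space norm `p` (a seminorm vanishing only at `0`) with `p (x * y) = p x * p y`. -/
structure IsAbsoluteValued (A : Type*) [NonUnitalNonAssocRing A] [Module ℝ A] : Prop where
  nontrivial : Nontrivial A
  exists_norm : ∃ p : Seminorm ℝ A,
    (∀ x : A, p x = 0 → x = 0) ∧ ∀ x y : A, p (x * y) = p x * p y

/-- Isomorphism of (nonassociative) real algebras: a multiplicative linear bijection. -/
def IsIsomorphicAlgebra (A B : Type*) [NonUnitalNonAssocRing A] [Module ℝ A]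
    [NonUnitalNonAssocRing B] [Module ℝ B] : Prop :=
  ∃ f : A ≃ₗ[ℝ] B, ∀ x y : A, f (x * y) = f x * f y

/-- `A` has degree `n`: `n` is the smallest natural number such that every subalgebra of `A`
generated by one element has dimension at most `n`. -/
def HasDegree (A : Type*) [NonUnitalNonAssocRing A] [Module ℝ A] [IsScalarTower ℝ A A]
    [SMulCommClass ℝ A A] (n : ℕ) : Prop :=
  IsLeast {m : ℕ | ∀ x : A, Module.rank ℝ (NonUnitalAlgebra.adjoin ℝ {x}) ≤ (m : Cardinal)} n

/-- The real vector space of quaternions, to be endowed with the product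
`x ⊙ y = f x * g y`, for linear maps `f` and `g`. -/
def QuaternionIsotope (_f _g : ℍ[ℝ] →ₗ[ℝ] ℍ[ℝ]) : Type := ℍ[ℝ]

namespace QuaternionIsotope

variable (f g : ℍ[ℝ] →ₗ[ℝ] ℍ[ℝ])

noncomputable instance : AddCommGroup (QuaternionIsotope f g) :=
  inferInstanceAs (AddCommGroup ℍ[ℝ])

noncomputable instance : Module ℝ (QuaternionIsotope f g) :=
  inferInstanceAs (Module ℝ ℍ[ℝ])

/-- The identity map from the quaternions to the isotope. -/
noncomputable def of : ℍ[ℝ] ≃ₗ[ℝ] QuaternionIsotope f g := LinearEquiv.refl ℝ ℍ[ℝ]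

noncomputable instance : Mul (QuaternionIsotope f g) :=
  ⟨fun x y => of f g (f ((of f g).symm x) * g ((of f g).symm y))⟩

theorem of_mul_of (x y : ℍ[ℝ]) : of f g x * of f g y = of f g (f x * g y) := rfl

theorem mul_def (x y : QuaternionIsotope f g) :
    x * y = of f g (f ((of f g).symm x) * g ((of f g).symm y)) := rfl

noncomputable instance : NonUnitalNonAssocRing (QuaternionIsotope f g) where
  left_distrib x y z := by simp only [mul_def, map_add, mul_add]
  right_distrib x y z := by simp only [mul_def, map_add, add_mul]
  zero_mul x := by simp only [mul_def, map_zero, zero_mul]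
  mul_zero x := by simp only [mul_def, map_zero, mul_zero]

instance : IsScalarTower ℝ (QuaternionIsotope f g) (QuaternionIsotope f g) where
  smul_assoc r x y := by simp only [mul_def, smul_eq_mul, map_smul, smul_mul_assoc]

instance : SMulCommClass ℝ (QuaternionIsotope f g) (QuaternionIsotope f g) where
  smul_comm r x y := by simp only [mul_def, smul_eq_mul, map_smul, mul_smul_comm]

end QuaternionIsotope

/-- Quaternion conjugation as a real linear map. -/
noncomputable def quaternionConj : ℍ[ℝ] →ₗ[ℝ] ℍ[ℝ] where
  toFun x := star x
  map_add' x y := star_add x y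
  map_smul' r x := by simp

theorem quaternionConj_apply (x : ℍ[ℝ]) : quaternionConj x = star x := rfl

/-- The algebra `*ℍ`: the quaternions with product `x ⊙ y = x̄ y`. -/
abbrev StarH : Type := QuaternionIsotope quaternionConj LinearMap.id

/-- The algebra `*ℍ(a, b)`: the quaternions with product `x ⊙ y = x̄ a y b`. -/
abbrev StarHIsotope (a b : ℍ[ℝ]) : Type :=
  QuaternionIsotope (LinearMap.mulRight ℝ a ∘ₗ quaternionConj) (LinearMap.mulRight ℝ b)

theorem StarH.of_mul_of (x y : ℍ[ℝ]) :
    (QuaternionIsotope.of _ _ x * QuaternionIsotope.of _ _ y : StarH) =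
      QuaternionIsotope.of _ _ (star x * y) := rfl

theorem StarHIsotope.of_mul_of (a b x y : ℍ[ℝ]) :
    (QuaternionIsotope.of _ _ x * QuaternionIsotope.of _ _ y : StarHIsotope a b) =
      QuaternionIsotope.of _ _ (star x * a * y * b) := by
  rw [QuaternionIsotope.of_mul_of]
  simp only [LinearMap.comp_apply, quaternionConj_apply, LinearMap.mulRight_apply, mul_assoc]

/-- The quaternion unit `i`. -/
noncomputable def quaternionI : ℍ[ℝ] := ⟨0, 1, 0, 0⟩

/-!
The norm of a finite-dimensional absolute-valued algebra is Euclidean: the average over the unit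
ball of `l (x * y) ^ 2`, for a linear form `l ≠ 0`, is a quadratic form in `y`, and it is a positive
multiple of `‖y‖ ^ 2` because right multiplication by a unit vector is an isometry, which preserves
Lebesgue measure on the ball (`norm_parallelogram_of_norm_mul`).

Let `e` be a left unit and `dim A = 4`. For `x` orthogonal to `e`, left multiplication by `x` is
skew-adjoint with square `-‖x‖ ^ 2`, so three orthonormal such `x` give anticommuting complex
structures. Their product `T` satisfies `T ^ 2 = 1` and commutes with all left multiplications; as
`A` is a division algebra, `T = ±1`, and the left multiplications form a copy of `ℍ`
(`exists_quaternion_action`). Hence `A` is a free `ℍ`-module on `e`, and its product becomes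
`f x * y` on `ℍ`, for an isometry `f` fixing `1` (`IsAbsoluteValued.exists_twisted_quaternion`).

The same sign argument, now for `f i * f j * f k`, shows that `f` is an endomorphism or an
anti-endomorphism of `ℍ`. With `s = f x * x`, the square of `x` for the new product, the condition
on associators becomes `f (f s * s) = f s * f s`. After cancellation this forces `f = id` in the
first case, and `f ∘ f = id` in the second. In the second case `f` is the conjugation, giving `*ℍ`,
or the conjugation composed with a half-turn, giving `*ℍ(i, 1)`
(`isIsomorphicAlgebra_of_associator_sq`).

In `ℍ` and `*ℍ` the span of `1` and `x` is a subalgebra, while `1 + j` generates `*ℍ(i, 1)`.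
-/

open MeasureTheory Module

/-! ### Multiplicative norms are Euclidean -/

/-- A linear isometry preserves additive Haar measure: it scales the measure by a constant, which
is `1` because it preserves the unit ball. The norm need not come from an inner product. -/
theorem LinearIsometry.measurePreserving_addHaar {E : Type*} [NormedAddCommGroup E]
    [NormedSpace ℝ E] [FiniteDimensional ℝ E] [MeasurableSpace E] [BorelSpace E]
    (μ : Measure E) [μ.IsAddHaarMeasure] (T : E →ₗᵢ[ℝ] E) : MeasurePreserving T μ μ := by
  have hdet : LinearMap.det T.toLinearMap ≠ 0 := by
    intro h
    have := (LinearMap.bot_lt_ker_of_det_eq_zero h).ne'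
    exact this (LinearMap.ker_eq_bot.2 T.injective)
  have hmap := Measure.map_linearMap_addHaar_eq_smul_addHaar μ hdet
  have hmeas : Measurable T := T.continuous.measurable
  refine ⟨hmeas, ?_⟩
  have hball : μ.map T (Metric.closedBall 0 1) = μ (Metric.closedBall 0 1) := by
    rw [Measure.map_apply hmeas Metric.isClosed_closedBall.measurableSet]
    congr 1
    ext x
    simp
  have h0 : μ (Metric.closedBall (0 : E) 1) ≠ 0 :=
    (Metric.measure_closedBall_pos μ 0 one_pos).ne'
  have h1 : μ (Metric.closedBall (0 : E) 1) ≠ ⊤ := measure_closedBall_lt_top.ne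
  have hmap' : μ.map T = ENNReal.ofReal |(LinearMap.det T.toLinearMap)⁻¹| • μ := hmap
  rw [hmap', Measure.smul_apply, smul_eq_mul] at hball
  have : ENNReal.ofReal |(LinearMap.det T.toLinearMap)⁻¹| = 1 := by
    rwa [ENNReal.mul_eq_right h0 h1] at hball
  rw [hmap', this, one_smul]

/-- A multiplicative norm on a finite-dimensional algebra is Euclidean. For a linear form `l ≠ 0`,
the quadratic form `y ↦ ∫ l (x * y) ^ 2` (the integral over the unit ball of all `x`) is a positive
multiple of `‖y‖ ^ 2`, since right multiplication by a unit vector is an isometry. -/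
theorem norm_parallelogram_of_norm_mul {E : Type*} [NormedAddCommGroup E]
    [NormedSpace ℝ E] [FiniteDimensional ℝ E] (L : E →ₗ[ℝ] End ℝ E)
    (hL : ∀ x y, ‖L x y‖ = ‖x‖ * ‖y‖) (y z : E) :
    ‖y + z‖ * ‖y + z‖ + ‖y - z‖ * ‖y - z‖ = 2 * (‖y‖ * ‖y‖ + ‖z‖ * ‖z‖) := by
  cases subsingleton_or_nontrivial E
  · simp [Subsingleton.elim y 0, Subsingleton.elim z 0]
  let _ : MeasurableSpace E := borel E
  have : BorelSpace E := ⟨rfl⟩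
  let μ : Measure E := Measure.addHaar
  let B : Set E := Metric.closedBall 0 1
  obtain ⟨a, ha⟩ := exists_ne (0 : E)
  obtain ⟨l, hl⟩ : ∃ l : E →L[ℝ] ℝ, l a ≠ 0 := by
    obtain ⟨l, -, hl⟩ := exists_dual_vector ℝ a (norm_ne_zero_iff.2 ha)
    exact ⟨l, by simpa [hl] using ha⟩
  have hint : ∀ T : E →ₗ[ℝ] E, IntegrableOn (fun x => l (T x) ^ 2) B μ := fun T => by
    have : Continuous T := T.continuous_of_finiteDimensional
    exact (by fun_prop : Continuous fun x => l (T x) ^ 2).continuousOn.integrableOn_compact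
      (isCompact_closedBall 0 1)
  let c := ∫ x in B, l x ^ 2 ∂μ
  have hc : 0 < c := by
    refine (setIntegral_pos_iff_support_of_nonneg_ae (.of_forall fun x => sq_nonneg _)
      (hint LinearMap.id)).2 ?_
    refine lt_of_lt_of_le (IsOpen.measure_pos μ
      (((by fun_prop : Continuous fun x => l x ^ 2).isOpen_support).inter Metric.isOpen_ball)
      ⟨(2 * ‖a‖)⁻¹ • a, ?_, ?_⟩) (measure_mono (Set.inter_subset_inter_right _
        (Metric.ball_subset_closedBall (x := (0 : E)) (ε := 1))))
    · simp [ha, hl]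
    · have : ‖a‖ ≠ 0 := norm_ne_zero_iff.2 ha
      rw [mem_ball_zero_iff, norm_smul, norm_inv, norm_mul, norm_norm, mul_inv, mul_assoc,
        inv_mul_cancel₀ this]
      norm_num
  have key : ∀ y : E, ∫ x in B, l (L x y) ^ 2 ∂μ = ‖y‖ * ‖y‖ * c := by
    intro y
    rcases eq_or_ne y 0 with rfl | hy
    · simp
    have hy' : ‖y‖ ≠ 0 := norm_ne_zero_iff.2 hy
    -- right multiplication by `y`, rescaled to an isometry
    let T : E →ₗᵢ[ℝ] E := ⟨‖y‖⁻¹ • L.flip y, fun x => by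
      simp [norm_smul, hL]; field_simp⟩
    have hT : ∀ x, L x y = ‖y‖ • T x := fun x => by
      change _ = ‖y‖ • (‖y‖⁻¹ • L x y)
      rw [smul_smul, mul_inv_cancel₀ hy', one_smul]
    have hemb : MeasurableEmbedding T :=
      T.isometry.isClosedEmbedding.measurableEmbedding
    have h1 := (T.measurePreserving_addHaar μ).setIntegral_preimage_emb hemb
      (fun x => l x ^ 2) B
    have hB : T ⁻¹' B = B := by
      ext x; simp [B]
    rw [hB] at h1
    simp_rw [hT, map_smul, smul_eq_mul, mul_pow]
    rw [integral_const_mul, h1, pow_two]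
  have hadd : ∫ x in B, (l (L x (y + z)) ^ 2 + l (L x (y - z)) ^ 2) ∂μ
      = ∫ x in B, (2 * (l (L x y) ^ 2 + l (L x z) ^ 2)) ∂μ := by
    congr 1
    ext x
    simp only [map_add, map_sub]
    ring
  have hint' (y : E) : IntegrableOn (fun x => l (L x y) ^ 2) B μ := hint (L.flip y)
  rw [integral_add (hint' _) (hint' _), integral_const_mul, integral_add (hint' _) (hint' _),
    key, key, key, key] at hadd
  apply mul_right_cancel₀ hc.ne'
  linarith

/-! ### Quaternion units in real algebras -/

/-- The quaternion unit `j`. -/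
def quaternionJ : ℍ[ℝ] := ⟨0, 0, 1, 0⟩

/-- The quaternion unit `k`. -/
def quaternionK : ℍ[ℝ] := ⟨0, 0, 0, 1⟩

@[simp] theorem quaternionI_re : quaternionI.re = 0 := rfl
@[simp] theorem quaternionI_imI : quaternionI.imI = 1 := rfl
@[simp] theorem quaternionI_imJ : quaternionI.imJ = 0 := rfl
@[simp] theorem quaternionI_imK : quaternionI.imK = 0 := rfl
@[simp] theorem quaternionJ_re : quaternionJ.re = 0 := rfl
@[simp] theorem quaternionJ_imI : quaternionJ.imI = 0 := rfl
@[simp] theorem quaternionJ_imJ : quaternionJ.imJ = 1 := rfl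
@[simp] theorem quaternionJ_imK : quaternionJ.imK = 0 := rfl
@[simp] theorem quaternionK_re : quaternionK.re = 0 := rfl
@[simp] theorem quaternionK_imI : quaternionK.imI = 0 := rfl
@[simp] theorem quaternionK_imJ : quaternionK.imJ = 0 := rfl
@[simp] theorem quaternionK_imK : quaternionK.imK = 1 := rfl

theorem Quaternion.eq_sum_units (x : ℍ[ℝ]) :
    x = x.re • 1 + x.imI • quaternionI + x.imJ • quaternionJ + x.imK • quaternionK := by
  ext <;> simp

theorem triple_mul_self_eq_one {R : Type*} [Ring R] {u v w : R} (hu : u * u = -1)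
    (hv : v * v = -1) (hw : w * w = -1) (hvu : v * u = -(u * v)) (hwu : w * u = -(u * w))
    (hwv : w * v = -(v * w)) : (u * v * w) * (u * v * w) = 1 := by
  have h4 (z : R) : v * (u * z) = -(u * (v * z)) := by rw [← mul_assoc, hvu, neg_mul, mul_assoc]
  have h5 (z : R) : w * (u * z) = -(u * (w * z)) := by rw [← mul_assoc, hwu, neg_mul, mul_assoc]
  have h6 (z : R) : w * (v * z) = -(v * (w * z)) := by rw [← mul_assoc, hwv, neg_mul, mul_assoc]
  simp [mul_assoc, h4, h5, h6, hw, hv, hu]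

theorem mul_eq_of_triple_eq_neg_one {R : Type*} [Ring R] {u v w : R} (hw : w * w = -1)
    (h : u * v * w = -1) : u * v = w := by
  have := congrArg (· * w) h
  simp only [mul_assoc, hw] at this
  simpa [mul_assoc] using this

theorem commute_triple {R : Type*} [Ring R] {u v w : R} (hvu : v * u = -(u * v))
    (hwu : w * u = -(u * w)) (hwv : w * v = -(v * w)) :
    Commute (u * v * w) u ∧ Commute (u * v * w) v ∧ Commute (u * v * w) w := by
  have h4 (z : R) : v * (u * z) = -(u * (v * z)) := by rw [← mul_assoc, hvu, neg_mul, mul_assoc]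
  refine ⟨?_, ?_, ?_⟩
  · simp [Commute, SemiconjBy, mul_assoc, hwu, h4]
  · simp [Commute, SemiconjBy, mul_assoc, hwv, h4]
  · have h6 (z : R) : w * (v * z) = -(v * (w * z)) := by rw [← mul_assoc, hwv, neg_mul, mul_assoc]
    have h5 (z : R) : w * (u * z) = -(u * (w * z)) := by rw [← mul_assoc, hwu, neg_mul, mul_assoc]
    simp [Commute, SemiconjBy, mul_assoc, h5, h6]

/-- The unital homomorphism from the quaternions sending `i` to `u` and `j` to `v`, for
anticommuting square roots `u` and `v` of `-1`. -/
def quaternionHom {R : Type*} [Ring R] [Algebra ℝ R] {u v : R} (hu : u * u = -1)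
    (hv : v * v = -1) (hvu : v * u = -(u * v)) : ℍ[ℝ] →ₐ[ℝ] R :=
  QuaternionAlgebra.Basis.liftHom
    { i := u
      j := v
      k := u * v
      i_mul_i := by simp [hu]
      j_mul_j := by simp [hv]
      i_mul_j := rfl
      j_mul_i := by simp [hvu] }

theorem quaternionHom_apply {R : Type*} [Ring R] [Algebra ℝ R] {u v : R}
    (hu : u * u = -1) (hv : v * v = -1) (hvu : v * u = -(u * v)) (x : ℍ[ℝ]) :
    quaternionHom hu hv hvu x =
      x.re • 1 + x.imI • u + x.imJ • v + x.imK • (u * v) := by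
  rw [← Algebra.algebraMap_eq_smul_one]
  rfl

/-! ### Left multiplications of a Euclidean algebra with a left unit -/

section Clifford

open scoped RealInnerProductSpace

variable {E : Type*} [NormedAddCommGroup E] [InnerProductSpace ℝ E] {L : E →ₗ[ℝ] End ℝ E}

theorem inner_apply_apply_of_norm_mul (hL : ∀ x y, ‖L x y‖ = ‖x‖ * ‖y‖) (x y v : E) :
    ⟪L x v, L y v⟫ = ⟪x, y⟫ * (‖v‖ * ‖v‖) := by
  rw [real_inner_eq_norm_add_mul_self_sub_norm_mul_self_sub_norm_mul_self_div_two,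
    real_inner_eq_norm_add_mul_self_sub_norm_mul_self_sub_norm_mul_self_div_two x y,
    ← LinearMap.add_apply, ← map_add, hL, hL, hL]
  ring

theorem inner_apply_apply_of_norm_mul' (hL : ∀ x y, ‖L x y‖ = ‖x‖ * ‖y‖) (x v w : E) :
    ⟪L x v, L x w⟫ = (‖x‖ * ‖x‖) * ⟪v, w⟫ := by
  rw [real_inner_eq_norm_add_mul_self_sub_norm_mul_self_sub_norm_mul_self_div_two,
    real_inner_eq_norm_add_mul_self_sub_norm_mul_self_sub_norm_mul_self_div_two v w,
    ← map_add, hL, hL, hL]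
  ring

/-- Since `L e = 1`, the operator `L x` is skew-adjoint for `x` orthogonal to `e`; it is also `‖x‖`
times an isometry. -/
theorem mul_self_eq_neg_of_inner_eq_zero (hL : ∀ x y, ‖L x y‖ = ‖x‖ * ‖y‖) {e : E}
    (he : L e = 1) {x : E} (hx : ⟪x, e⟫ = 0) : L x * L x = -(‖x‖ * ‖x‖) • 1 := by
  have h0 (v : E) : ⟪L x v, v⟫ = 0 := by
    simpa [he, hx] using inner_apply_apply_of_norm_mul hL x e v
  have h1 (v w : E) : ⟪L x v, w⟫ = -⟪v, L x w⟫ := by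
    have := h0 (v + w)
    simp only [map_add, inner_add_left, inner_add_right, h0] at this
    rw [real_inner_comm (L x w)]
    linarith
  ext v
  refine ext_inner_right ℝ fun w => ?_
  simp [h1 (L x v), inner_apply_apply_of_norm_mul' hL, inner_smul_left]

theorem anticommute_of_inner_eq_zero (hL : ∀ x y, ‖L x y‖ = ‖x‖ * ‖y‖) {e : E}
    (he : L e = 1) {x y : E} (hx : ⟪x, e⟫ = 0) (hy : ⟪y, e⟫ = 0) (hxy : ⟪x, y⟫ = 0) :
    L y * L x = -(L x * L y) := by
  have h := mul_self_eq_neg_of_inner_eq_zero hL he (x := x + y) (by simp [inner_add_left, hx, hy])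
  rw [norm_add_sq_eq_norm_sq_add_norm_sq_real hxy, map_add, add_mul, mul_add, mul_add,
    mul_self_eq_neg_of_inner_eq_zero hL he hx, mul_self_eq_neg_of_inner_eq_zero hL he hy] at h
  rw [eq_neg_iff_add_eq_zero]
  linear_combination (norm := module) h

/-- The left multiplications of a four-dimensional Euclidean space with a norm-multiplicative
product and a left unit form a copy of the quaternions. Here `L x` is left multiplication by `x`. -/
theorem exists_quaternion_action [FiniteDimensional ℝ E] (hE : finrank ℝ E = 4)
    (hL : ∀ x y, ‖L x y‖ = ‖x‖ * ‖y‖) {e : E} (he : L e = 1) :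
    ∃ φ : ℍ[ℝ] ≃ₗ[ℝ] E, φ 1 = e ∧ (∀ x, ‖φ x‖ = ‖x‖) ∧
      ∀ x y, L (φ (x * y)) = L (φ x) * L (φ y) := by
  have : Nontrivial E := Module.nontrivial_of_finrank_pos (R := ℝ) (by omega)
  have hnorm : ‖e‖ = 1 := by
    obtain ⟨a, ha⟩ := exists_ne (0 : E)
    have := hL e a
    rw [he] at this
    simpa [ha] using this
  have horth : Orthonormal ℝ (({0} : Set (Fin 4)).domRestrict fun _ => e) := by
    refine ⟨fun _ => hnorm, fun i j hij => (hij (Subsingleton.elim i j)).elim⟩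
  obtain ⟨b, hb⟩ := horth.exists_orthonormalBasis_extension_of_card_eq (by simp [hE])
  have hb0 : b 0 = e := hb 0 rfl
  have hperp (i : Fin 4) (hi : i ≠ 0) : ⟪b i, e⟫ = 0 := by
    rw [← hb0]; exact b.orthonormal.2 hi
  have hsq (i : Fin 4) (hi : i ≠ 0) : L (b i) * L (b i) = -1 := by
    simp [mul_self_eq_neg_of_inner_eq_zero hL he (hperp i hi)]
  have hanti (i j : Fin 4) (hi : i ≠ 0) (hj : j ≠ 0) (hij : i ≠ j) :
      L (b j) * L (b i) = -(L (b i) * L (b j)) :=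
    anticommute_of_inner_eq_zero hL he (hperp i hi) (hperp j hj) (b.orthonormal.2 hij)
  have h12 := hanti 1 2 (by decide) (by decide) (by decide)
  have h13 := hanti 1 3 (by decide) (by decide) (by decide)
  have h23 := hanti 2 3 (by decide) (by decide) (by decide)
  have h1 := hsq 1 (by decide)
  have h2 := hsq 2 (by decide)
  have h3 := hsq 3 (by decide)
  obtain ⟨T, hT⟩ : ∃ T, T = L (b 1) * L (b 2) * L (b 3) := ⟨_, rfl⟩
  have hTT : T * T = 1 := hT ▸ triple_mul_self_eq_one h1 h2 h3 h12 h13 h23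
  -- `T` commutes with every left multiplication, as these are spanned by `1` and its three factors
  have hcomm (x : E) : Commute T (L x) := by
    obtain ⟨c1, c2, c3⟩ := commute_triple h12 h13 h23
    rw [← hT] at c1 c2 c3
    rw [← b.sum_repr x, Fin.sum_univ_four, map_add, map_add, map_add, map_smul, map_smul, map_smul,
      map_smul, hb0, he]
    exact ((((Commute.one_right T).smul_right _).add_right (c1.smul_right _)).add_right
      (c2.smul_right _)).add_right (c3.smul_right _)
  have hTsign : T = 1 ∨ T = -1 := by
    by_cases h : T + 1 = 0
    · exact Or.inr (eq_neg_of_add_eq_zero_left h)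
    left
    obtain ⟨w, hw⟩ : ∃ w, (T + 1) w ≠ 0 := by
      by_contra! hcon
      exact h (LinearMap.ext hcon)
    -- right multiplication by the eigenvector `T w + w` is onto, so the eigenspace is everything
    have hinj : Function.Injective (L.flip ((T + 1) w)) := by
      rw [← LinearMap.ker_eq_bot, LinearMap.ker_eq_bot']
      intro x hx
      have := hL x ((T + 1) w)
      rw [LinearMap.flip_apply] at hx
      rw [hx, norm_zero] at this
      simpa using (mul_eq_zero.1 this.symm).resolve_right (norm_ne_zero_iff.2 hw)
    have hfix : T ((T + 1) w) = (T + 1) w := by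
      rw [← Module.End.mul_apply, mul_add, hTT, mul_one, add_comm]
    ext y
    obtain ⟨x, rfl⟩ := LinearMap.surjective_of_injective hinj y
    rw [LinearMap.flip_apply, ← Module.End.mul_apply, (hcomm x).eq, Module.End.mul_apply, hfix]
    rfl
  -- `ε` corrects the orientation of the basis `b`
  obtain ⟨ε, hε, hεT⟩ : ∃ ε : ℝ, ε * ε = 1 ∧ L (b 1) * L (b 2) = ε • L (b 3) := by
    rcases hTsign with h | h
    · refine ⟨-1, by norm_num, ?_⟩
      have := mul_eq_of_triple_eq_neg_one (u := L (b 1)) (v := L (b 2)) (w := -L (b 3))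
        (by simpa using h3) (by rw [mul_neg, ← hT, h])
      simpa using this
    · exact ⟨1, by norm_num, by simpa using mul_eq_of_triple_eq_neg_one h3 (hT ▸ h)⟩
  let F := quaternionHom h1 h2 h12
  let φ : ℍ[ℝ] →ₗ[ℝ] E :=
    { toFun x := x.re • b 0 + x.imI • b 1 + x.imJ • b 2 + (ε * x.imK) • b 3
      map_add' x y := by simp only [Quaternion.re_add, Quaternion.imI_add, Quaternion.imJ_add,
                          Quaternion.imK_add]; module
      map_smul' r x := by simp only [Quaternion.re_smul, Quaternion.imI_smul, Quaternion.imJ_smul,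
                          Quaternion.imK_smul, RingHom.id_apply, smul_eq_mul]; module }
  have hφ (x : ℍ[ℝ]) : φ x = x.re • b 0 + x.imI • b 1 + x.imJ • b 2 + (ε * x.imK) • b 3 := rfl
  have hF (x : ℍ[ℝ]) : L (φ x) = F x := by
    rw [hφ, quaternionHom_apply, hεT, hb0]
    simp only [map_add, map_smul, he]
    module
  have hinj : Function.Injective φ := by
    intro x y hxy
    apply F.toRingHom.injective
    change F x = F y
    rw [← hF, ← hF, hxy]
  obtain ⟨ψ, hψ⟩ : ∃ ψ : ℍ[ℝ] ≃ₗ[ℝ] E, ∀ x, ψ x = φ x :=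
    ⟨LinearEquiv.ofInjectiveOfFinrankEq φ hinj (by rw [Quaternion.finrank_eq_four, hE]),
      fun _ => rfl⟩
  refine ⟨ψ, ?_, fun x => ?_, fun x y => ?_⟩
  · simp [hψ, hφ, hb0]
  · rw [hψ]
    have h : ‖φ x‖ ^ 2 = ‖x‖ ^ 2 := by
      rw [pow_two ‖x‖, ← Quaternion.normSq_eq_norm_mul_self, Quaternion.normSq_def',
        ← real_inner_self_eq_norm_sq, hφ]
      simp only [inner_add_left, inner_add_right, inner_smul_left, inner_smul_right,
        b.inner_eq_ite]
      simp
      linear_combination x.imK ^ 2 * hε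
    exact (pow_left_inj₀ (norm_nonneg _) (norm_nonneg _) two_ne_zero).1 h
  · simp only [hψ, hF, map_mul]

end Clifford

/-! ### Isometries of the quaternions fixing `1` -/

namespace Quaternion

theorem mul_self_eq_neg_normSq {q : ℍ[ℝ]} (hq : q.re = 0) : q * q = -((normSq q : ℝ) : ℍ[ℝ]) := by
  rw [← pow_two]; exact sq_eq_neg_normSq.2 hq

theorem exists_smul_mul_self_eq_neg_one {q : ℍ[ℝ]} (hq : q.re = 0) (h0 : q ≠ 0) :
    ∃ r : ℝ, (r • q) * (r • q) = -1 := by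
  refine ⟨‖q‖⁻¹, ?_⟩
  have : ‖q‖ ≠ 0 := norm_ne_zero_iff.2 h0
  rw [smul_mul_smul_comm, mul_self_eq_neg_normSq hq, normSq_eq_norm_mul_self, ← coe_neg,
    ← coe_smul, smul_eq_mul, ← mul_inv, mul_neg, inv_mul_cancel₀ (mul_ne_zero this this)]
  simp

theorem algHom_star {F : ℍ[ℝ] →ₐ[ℝ] ℍ[ℝ]} (hre : ∀ x, (F x).re = x.re) (x : ℍ[ℝ]) :
    F (star x) = star (F x) := by
  have h (x : ℍ[ℝ]) : star x = (2 * x.re) • 1 - x := by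
    ext <;> simp
    ring
  rw [h x, h (F x), map_sub, map_smul, map_one, hre]

theorem re_eq_zero_of_anticommute {u v : ℍ[ℝ]} (hv : v * v = -1) (hvu : v * u = -(u * v)) :
    u.re = 0 := by
  have h : v * u * v = u := by rw [hvu, neg_mul, mul_assoc, hv]; simp
  have h2 : (v * u * v).re = (v * v * u).re := by simp; ring
  rw [h, hv] at h2
  simp at h2
  linarith

open scoped RealInnerProductSpace in
/-- An isometry `f` of the quaternions fixing `1` is an algebra endomorphism or anti-endomorphism,
according to the sign `f i * f j * f k = ∓1`. -/
theorem exists_algHom_of_norm_map {f : ℍ[ℝ] →ₗ[ℝ] ℍ[ℝ]} (h1 : f 1 = 1)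
    (hf : ∀ x, ‖f x‖ = ‖x‖) :
    ∃ F : ℍ[ℝ] →ₐ[ℝ] ℍ[ℝ], (∀ x, (F x).re = x.re) ∧
      ((∀ x, f x = F x) ∨ ∀ x, f x = F (star x)) := by
  have hinner (x : ℍ[ℝ]) : ⟪f x, f 1⟫ = ⟪x, 1⟫ := by
    rw [real_inner_eq_norm_add_mul_self_sub_norm_mul_self_sub_norm_mul_self_div_two, ← map_add,
      hf, hf, hf, ← real_inner_eq_norm_add_mul_self_sub_norm_mul_self_sub_norm_mul_self_div_two]
  have hre (x : ℍ[ℝ]) : (f x).re = x.re := by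
    simpa [h1, inner_def] using hinner x
  have hsq {x : ℍ[ℝ]} (hx : x.re = 0) : f x * f x = x * x := by
    rw [mul_self_eq_neg_normSq hx, mul_self_eq_neg_normSq ((hre x).trans hx),
      normSq_eq_norm_mul_self, normSq_eq_norm_mul_self, hf]
  have hanti {x y : ℍ[ℝ]} (hx : x.re = 0) (hy : y.re = 0) (hxy : y * x = -(x * y)) :
      f y * f x = -(f x * f y) := by
    have h := hsq (x := x + y) (by simp [hx, hy])
    rw [map_add, add_mul, mul_add, mul_add, add_mul, mul_add, mul_add, hsq hx, hsq hy, hxy] at h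
    rw [eq_neg_iff_add_eq_zero]
    linear_combination (norm := module) h
  have hfx (x : ℍ[ℝ]) : f x = x.re • 1 + x.imI • f quaternionI + x.imJ • f quaternionJ +
      x.imK • f quaternionK := by
    conv_lhs => rw [eq_sum_units x]
    simp only [map_add, map_smul, h1]
  have hii : f quaternionI * f quaternionI = -1 := by rw [hsq rfl]; ext <;> simp
  have hjj : f quaternionJ * f quaternionJ = -1 := by rw [hsq rfl]; ext <;> simp
  have hkk : f quaternionK * f quaternionK = -1 := by rw [hsq rfl]; ext <;> simp
  have hij : f quaternionJ * f quaternionI = -(f quaternionI * f quaternionJ) :=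
    hanti rfl rfl (by ext <;> simp)
  have hik : f quaternionK * f quaternionI = -(f quaternionI * f quaternionK) :=
    hanti rfl rfl (by ext <;> simp)
  have hjk : f quaternionK * f quaternionJ = -(f quaternionJ * f quaternionK) :=
    hanti rfl rfl (by ext <;> simp)
  have hT : f quaternionI * f quaternionJ * f quaternionK = 1 ∨
      f quaternionI * f quaternionJ * f quaternionK = -1 :=
    mul_self_eq_one_iff.1 (triple_mul_self_eq_one hii hjj hkk hij hik hjk)
  rcases hT with hT | hT
  -- here `f` reverses orientation, and `x ↦ f (star x)` is the endomorphism
  · have hk := mul_eq_of_triple_eq_neg_one (u := -f quaternionI) (v := -f quaternionJ)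
      (w := -f quaternionK) (by simpa using hkk) (by simpa using hT)
    have hF (x : ℍ[ℝ]) : f x = quaternionHom (u := -f quaternionI) (v := -f quaternionJ)
        (by simpa using hii) (by simpa using hjj) (by simpa using hij) (star x) := by
      rw [hfx, quaternionHom_apply, hk]
      simp
    refine ⟨_, fun x => ?_, Or.inr hF⟩
    have := hF (star x)
    rw [star_star] at this
    rw [← this, hre, re_star]
  · have hk := mul_eq_of_triple_eq_neg_one hkk hT
    have hF (x : ℍ[ℝ]) : f x = quaternionHom hii hjj hij x := by
      rw [hfx, quaternionHom_apply, hk]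
    exact ⟨_, fun x => by rw [← hF, hre], Or.inl hF⟩

/-- An involutive endomorphism of the quaternions other than the identity is a half-turn: it fixes
an imaginary unit `u` and negates an orthogonal imaginary unit `v`. -/
theorem exists_eigenvectors_of_involutive {F : ℍ[ℝ] →ₐ[ℝ] ℍ[ℝ]} (hre : ∀ x, (F x).re = x.re)
    (hF : ∀ x, F (F x) = x) (hne : ∃ x, F x ≠ x) :
    ∃ u v : ℍ[ℝ], u * u = -1 ∧ v * v = -1 ∧ v * u = -(u * v) ∧ F u = u ∧ F v = -v := by
  obtain ⟨v, hvv, hFv⟩ : ∃ v : ℍ[ℝ], v * v = -1 ∧ F v = -v := by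
    obtain ⟨x, hx⟩ := hne
    obtain ⟨r, hr⟩ := exists_smul_mul_self_eq_neg_one (q := F x - x) (by simp [hre])
      (sub_ne_zero.2 hx)
    exact ⟨_, hr, by rw [map_smul, map_sub, hF, ← smul_neg, neg_sub]⟩
  have hv0 : v ≠ 0 := by rintro rfl; simp at hvv
  have hvre : v.re = 0 := by
    have := hre v
    rw [hFv, re_neg] at this
    linarith
  -- `v` is not central, and commutators with `v` anticommute with `v`
  obtain ⟨p, hp⟩ : ∃ p : ℍ[ℝ], p * v - v * p ≠ 0 := by
    by_contra! h
    have hi := h quaternionI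
    have hj := h quaternionJ
    apply hv0
    simp only [Quaternion.ext_iff, re_sub, re_mul, imI_sub, imI_mul, imJ_sub, imJ_mul, imK_sub,
      imK_mul, re_zero, imI_zero, imJ_zero, imK_zero, quaternionI_re, quaternionI_imI,
      quaternionI_imJ, quaternionI_imK, quaternionJ_re, quaternionJ_imI, quaternionJ_imJ,
      quaternionJ_imK] at hi hj ⊢
    refine ⟨hvre, ?_, ?_, ?_⟩ <;> linarith [hi.2.2.1, hi.2.2.2, hj.2.2.2]
  have hyv : v * (p * v - v * p) = -((p * v - v * p) * v) := by
    rw [mul_sub, sub_mul, ← mul_assoc v v, mul_assoc p v v, hvv, mul_assoc v p v]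
    noncomm_ring
  obtain ⟨y, hy⟩ : ∃ y, y = p * v - v * p := ⟨_, rfl⟩
  rw [← hy] at hp hyv
  obtain ⟨u, hu0, huv, hFu⟩ : ∃ u : ℍ[ℝ], u ≠ 0 ∧ v * u = -(u * v) ∧ F u = u := by
    by_cases h : y + F y = 0
    · have hFy : F y = -y := by rwa [add_comm, add_eq_zero_iff_eq_neg] at h
      refine ⟨v * y, mul_ne_zero hv0 hp, ?_, ?_⟩
      · rw [mul_assoc v y v, ← mul_neg, ← hyv]
      · rw [map_mul, hFv, hFy, neg_mul_neg]
    · refine ⟨_, h, ?_, by rw [map_add, hF, add_comm]⟩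
      have := congrArg F hyv
      simp only [map_mul, map_neg, hFv, neg_mul, mul_neg, neg_neg] at this
      rw [mul_add, add_mul, hyv, neg_add, ← this, neg_neg]
  obtain ⟨r, hr⟩ := exists_smul_mul_self_eq_neg_one
    (re_eq_zero_of_anticommute hvv huv) hu0
  exact ⟨r • u, v, hr, hvv, by simp [huv], by rw [map_smul, hFu], hFv⟩

/-- The hypothesis `h` says that `(s, s, s) = 0` for all squares `s` of the product `F x * y`, with
a right factor `s` cancelled. -/
theorem eq_self_of_algHom_of_sq {F : ℍ[ℝ] →ₐ[ℝ] ℍ[ℝ]} (hre : ∀ x, (F x).re = x.re)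
    (h : ∀ x, F (F (F x * x) * (F x * x)) = F (F x * x) * F (F x * x)) (x : ℍ[ℝ]) :
    F x = x := by
  have hinj : Function.Injective F := F.toRingHom.injective
  have h1 (x : ℍ[ℝ]) : F (F x) * F x = F x * x := by
    rcases eq_or_ne x 0 with rfl | hx
    · simp
    have hx' : F x ≠ 0 := (map_ne_zero_iff F hinj).2 hx
    have := h x
    rw [map_mul] at this
    rw [← map_mul]
    exact hinj (mul_right_cancel₀ ((map_ne_zero_iff F hinj).2 (mul_ne_zero hx' hx)) this)
  -- polarize `h1` at `x` and `1`
  have h2 (x : ℍ[ℝ]) : F (F x) = x := by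
    have := h1 (x + 1)
    simp only [map_add, map_one, add_mul, mul_add, mul_one, one_mul, h1] at this
    linear_combination (norm := module) this
  -- otherwise `F` is a half-turn, and `u + v` does not commute with its image `u - v`
  by_contra hx
  obtain ⟨u, v, huu, hvv, huv, hu, hv⟩ := exists_eigenvectors_of_involutive hre h2 ⟨x, hx⟩
  have := h1 (u + v)
  rw [h2, map_add, hu, hv] at this
  have h0 : u * v = 0 := by
    simp only [add_mul, mul_add, huv, neg_mul, mul_neg] at this
    have h4 : (4 : ℝ) • (u * v) = 0 := by linear_combination (norm := module) -this
    simpa using h4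
  rcases mul_eq_zero.1 h0 with rfl | rfl
  · simp at huu
  · simp at hvv

/-- The hypothesis `h` says that `(s, s, s) = 0` for all squares `s` of the product `f x * y`, where
`f` is an anti-endomorphism, with a right factor `s` cancelled. -/
theorem involutive_of_sq {F : ℍ[ℝ] →ₐ[ℝ] ℍ[ℝ]} {f : ℍ[ℝ] → ℍ[ℝ]} (hf : ∀ x, f x = F (star x))
    (h : ∀ x, f (f (f x * x) * (f x * x)) = f (f x * x) * f (f x * x)) (x : ℍ[ℝ]) :
    f (f x) = x := by
  have hmul (x y : ℍ[ℝ]) : f (x * y) = f y * f x := by simp [hf]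
  have hinj : Function.Injective f := fun x y hxy => by
    rw [hf, hf] at hxy
    exact star_injective (F.toRingHom.injective hxy)
  have h0 : f 0 = 0 := by simp [hf]
  have hne {x : ℍ[ℝ]} (hx : x ≠ 0) : f x ≠ 0 := fun h => hx (hinj (h.trans h0.symm))
  rcases eq_or_ne x 0 with rfl | hx
  · rw [h0, h0]
  have h1 := h x
  rw [hmul] at h1
  have h2 := hinj (mul_left_cancel₀ (hne (mul_ne_zero (hne hx) hx)) h1)
  rw [hmul] at h2
  exact mul_left_cancel₀ (hne hx) h2

end Quaternion

/-! ### Degrees -/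

section Degree

variable {A : Type*} [NonUnitalNonAssocRing A] [Module ℝ A] [IsScalarTower ℝ A A]
  [SMulCommClass ℝ A A]

theorem hasDegree_of_linearIndependent {n : ℕ}
    (hle : ∀ x : A, Module.rank ℝ (NonUnitalAlgebra.adjoin ℝ {x}) ≤ n) (x : A) {v : Fin n → A}
    (hv : LinearIndependent ℝ v) (hmem : ∀ i, v i ∈ NonUnitalAlgebra.adjoin ℝ {x}) :
    HasDegree A n := by
  refine ⟨hle, fun m hm => ?_⟩
  have h1 : LinearIndependent ℝ (fun i => (⟨v i, hmem i⟩ : NonUnitalAlgebra.adjoin ℝ {x})) :=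
    LinearIndependent.of_comp (NonUnitalAlgebra.adjoin ℝ {x}).toSubmodule.subtype hv
  have h2 := h1.cardinal_lift_le_rank.trans (Cardinal.lift_le.2 (hm x))
  simpa using h2

theorem rank_adjoin_singleton_le_two {x a b : A} (hx : x ∈ Submodule.span ℝ {a, b})
    (haa : a * a ∈ Submodule.span ℝ {a, b}) (hab : a * b ∈ Submodule.span ℝ {a, b})
    (hba : b * a ∈ Submodule.span ℝ {a, b}) (hbb : b * b ∈ Submodule.span ℝ {a, b}) :
    Module.rank ℝ (NonUnitalAlgebra.adjoin ℝ {x}) ≤ 2 := by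
  let S : NonUnitalSubalgebra ℝ A :=
    { Submodule.span ℝ {a, b} with
      mul_mem' := by
        intro y z hy hz
        obtain ⟨r, s, rfl⟩ := Submodule.mem_span_pair.1 hy
        obtain ⟨t, u, rfl⟩ := Submodule.mem_span_pair.1 hz
        simp only [add_mul, mul_add, smul_mul_smul_comm]
        exact add_mem (add_mem (Submodule.smul_mem _ _ haa) (Submodule.smul_mem _ _ hba))
          (add_mem (Submodule.smul_mem _ _ hab) (Submodule.smul_mem _ _ hbb)) }
  have hS : NonUnitalAlgebra.adjoin ℝ {x} ≤ S :=
    NonUnitalAlgebra.adjoin_le (Set.singleton_subset_iff.2 hx)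
  calc Module.rank ℝ (NonUnitalAlgebra.adjoin ℝ {x})
      ≤ Module.rank ℝ (Submodule.span ℝ {a, b}) :=
        Submodule.rank_mono (s := (NonUnitalAlgebra.adjoin ℝ {x}).toSubmodule) hS
    _ ≤ Cardinal.mk ({a, b} : Set A) := rank_span_le _
    _ ≤ 2 := by
        refine Cardinal.mk_insert_le.trans ?_
        rw [Cardinal.mk_singleton, one_add_one_eq_two]

end Degree

theorem Quaternion.linearIndependent_one_quaternionI :
    LinearIndependent ℝ ![(1 : ℍ[ℝ]), quaternionI] := by
  rw [LinearIndependent.pair_iff]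
  intro s t h
  simpa [Quaternion.ext_iff] using h

theorem hasDegree_quaternion : HasDegree ℍ[ℝ] 2 := by
  refine hasDegree_of_linearIndependent (fun x => ?_) quaternionI
    Quaternion.linearIndependent_one_quaternionI ?_
  · refine rank_adjoin_singleton_le_two (a := 1) (b := x) (Submodule.mem_span_of_mem (by simp))
      (Submodule.mem_span_of_mem (by simp)) (Submodule.mem_span_of_mem (by simp))
      (Submodule.mem_span_of_mem (by simp)) (Submodule.mem_span_pair.2
        ⟨-Quaternion.normSq x, 2 * x.re, ?_⟩)
    ext <;> simp [Quaternion.normSq_def'] <;> ring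
  · have hx := NonUnitalAlgebra.self_mem_adjoin_singleton ℝ quaternionI
    rw [Fin.forall_fin_two]
    refine ⟨?_, hx⟩
    have h : (1 : ℍ[ℝ]) = -(quaternionI * quaternionI) := by
      ext <;> simp
    change (1 : ℍ[ℝ]) ∈ _
    rw [h]
    exact neg_mem (mul_mem hx hx)

/-- The subalgebra generated by `x` lies in the span of `1` and `x`; for `x = i` it contains
`i ⊙ i = 1`. -/
theorem hasDegree_starH : HasDegree StarH 2 := by
  obtain ⟨φ, hφ⟩ : ∃ φ : ℍ[ℝ] ≃ₗ[ℝ] StarH, ∀ x y, φ x * φ y = φ (star x * y) :=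
    ⟨_, StarH.of_mul_of⟩
  refine hasDegree_of_linearIndependent (fun x => ?_) (φ quaternionI)
    (Quaternion.linearIndependent_one_quaternionI.map' φ.toLinearMap φ.ker) ?_
  · obtain ⟨x, rfl⟩ := φ.surjective x
    refine rank_adjoin_singleton_le_two (a := φ 1) (b := φ x) (Submodule.mem_span_of_mem (by simp))
      (Submodule.mem_span_of_mem (by simp [hφ])) (Submodule.mem_span_of_mem (by simp [hφ]))
      (Submodule.mem_span_pair.2 ⟨2 * x.re, -1, ?_⟩)
      (Submodule.mem_span_pair.2 ⟨Quaternion.normSq x, 0, ?_⟩) <;>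
    rw [hφ, ← map_smul, ← map_smul, ← map_add] <;> congr 1
    · ext <;> simp; ring
    · rw [Quaternion.star_mul_self]
      ext <;> simp
  · have hx := NonUnitalAlgebra.self_mem_adjoin_singleton ℝ (φ quaternionI)
    rw [Fin.forall_fin_two]
    refine ⟨?_, hx⟩
    have h : (1 : ℍ[ℝ]) = star quaternionI * quaternionI := by
      ext <;> simp
    change φ 1 ∈ _
    rw [h, ← hφ]
    exact mul_mem hx hx

theorem Quaternion.linearIndependent_units :
    LinearIndependent ℝ ![(1 : ℍ[ℝ]), quaternionI, quaternionJ, quaternionK] := by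
  rw [Fintype.linearIndependent_iff]
  intro g h i
  simp only [Fin.sum_univ_four, Quaternion.ext_iff] at h
  fin_cases i <;> simp at h <;> simp [h]

/-- The element `1 + j` generates the whole of `*ℍ(i, 1)`. -/
theorem hasDegree_starHIsotope : HasDegree (StarHIsotope quaternionI 1) 4 := by
  obtain ⟨φ, hφ⟩ : ∃ φ : ℍ[ℝ] ≃ₗ[ℝ] StarHIsotope quaternionI 1,
      ∀ x y, φ x * φ y = φ (star x * quaternionI * y * 1) := ⟨_, StarHIsotope.of_mul_of _ _⟩
  refine hasDegree_of_linearIndependent (fun x => ?_) (φ (1 + quaternionJ))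
    (Quaternion.linearIndependent_units.map' φ.toLinearMap φ.ker) ?_
  · refine (Submodule.rank_le (NonUnitalAlgebra.adjoin ℝ {x}).toSubmodule).trans ?_
    rw [← φ.rank_eq, Quaternion.rank_eq_four]
    rfl
  · have hx := NonUnitalAlgebra.self_mem_adjoin_singleton ℝ (φ (1 + quaternionJ))
    set S := NonUnitalAlgebra.adjoin ℝ {φ (1 + quaternionJ)}
    have hk : φ quaternionK ∈ S := by
      have h : φ quaternionK = (1 / 2 : ℝ) • (φ (1 + quaternionJ) * φ (1 + quaternionJ)) := by
        rw [hφ, ← map_smul]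
        congr 1
        ext <;> simp; norm_num
      rw [h]
      exact SMulMemClass.smul_mem _ (mul_mem hx hx)
    have hi : φ quaternionI ∈ S := by
      have h : φ quaternionI = -(φ quaternionK * φ quaternionK) := by
        rw [hφ, ← map_neg]
        congr 1
        ext <;> simp
      rw [h]
      exact neg_mem (mul_mem hk hk)
    have h1 : φ 1 ∈ S := by
      have h : φ 1 = (1 / 2 : ℝ) • (φ (1 + quaternionJ) - φ (1 + quaternionJ) * φ quaternionI) := by
        rw [hφ, ← map_sub, ← map_smul]
        congr 1
        ext <;> simp; norm_num
      rw [h]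
      exact SMulMemClass.smul_mem _ (sub_mem hx (mul_mem hx hi))
    have hj : φ quaternionJ ∈ S := by
      have h : φ quaternionJ = φ (1 + quaternionJ) - φ 1 := by
        rw [← map_sub, add_sub_cancel_left]
      rw [h]
      exact sub_mem hx h1
    intro i
    fin_cases i
    exacts [h1, hi, hj, hk]

/-! ### The classification -/

/-- A four-dimensional absolute-valued algebra with a left unit is, up to isomorphism `ψ`, the space
of quaternions with product `f x * y`, for an isometry `f` fixing `1`. -/
theorem IsAbsoluteValued.exists_twisted_quaternion {A : Type*} [NonUnitalNonAssocRing A]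
    [Module ℝ A] [IsScalarTower ℝ A A] [SMulCommClass ℝ A A] (hA : IsAbsoluteValued A)
    (he : ∃ e : A, ∀ x : A, e * x = x) (hdim : finrank ℝ A = 4) :
    ∃ (f : ℍ[ℝ] →ₗ[ℝ] ℍ[ℝ]) (ψ : ℍ[ℝ] ≃ₗ[ℝ] A), f 1 = 1 ∧ (∀ x, ‖f x‖ = ‖x‖) ∧
      ∀ x y, ψ (f x * y) = ψ x * ψ y := by
  obtain ⟨p, hp0, hp⟩ := hA.exists_norm
  obtain ⟨e, he⟩ := he
  have hfin : FiniteDimensional ℝ A := Module.finite_of_finrank_pos (by omega)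
  let _ : Norm A := ⟨p⟩
  have core : NormedSpace.Core ℝ A :=
    { norm_nonneg := fun x => apply_nonneg p x
      norm_smul := fun c x => map_smul_eq_mul p c x
      norm_triangle := fun x y => map_add_le_add p x y
      norm_eq_zero_iff := fun x => ⟨hp0 x, fun h => by rw [h]; exact map_zero p⟩ }
  let _ : NormedAddCommGroup A := NormedAddCommGroup.ofCore core
  let _ : NormedSpace ℝ A := NormedSpace.ofCore core
  let L : A →ₗ[ℝ] End ℝ A := LinearMap.mul ℝ A
  have hLmul (x y : A) : L x y = x * y := rfl
  have hL (x y : A) : ‖L x y‖ = ‖x‖ * ‖y‖ := hp x y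
  let _ : InnerProductSpace ℝ A := InnerProductSpace.ofNorm ℝ (norm_parallelogram_of_norm_mul L hL)
  have hLe : L e = 1 := LinearMap.ext he
  obtain ⟨φ, hφ1, hφn, hφ⟩ := exists_quaternion_action hdim hL hLe
  have hmul (x y : ℍ[ℝ]) (a : A) : φ (x * y) * a = φ x * (φ y * a) :=
    LinearMap.congr_fun (hφ x y) a
  have he1 : ‖e‖ = 1 := by rw [← hφ1, hφn, norm_one]
  have hnorm (x : ℍ[ℝ]) : ‖φ x * e‖ = ‖x‖ := by rw [← hLmul, hL, hφn, he1, mul_one]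
  -- identify `A` with the quaternions through the orbit map of `e`, so that `f = φ⁻¹ ∘ ψ`
  let ψ₀ : ℍ[ℝ] →ₗ[ℝ] A := L.flip e ∘ₗ φ.toLinearMap
  have hψ₀ (x : ℍ[ℝ]) : ψ₀ x = φ x * e := rfl
  have hinj : Function.Injective ψ₀ := by
    rw [← LinearMap.ker_eq_bot, LinearMap.ker_eq_bot']
    intro x hx
    rw [← norm_eq_zero, ← hnorm, ← hψ₀, hx, norm_zero]
  obtain ⟨ψ, hψ⟩ : ∃ ψ : ℍ[ℝ] ≃ₗ[ℝ] A, ∀ x, ψ x = φ x * e :=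
    ⟨LinearEquiv.ofInjectiveOfFinrankEq ψ₀ hinj (by rw [Quaternion.finrank_eq_four, hdim]),
      fun _ => rfl⟩
  refine ⟨φ.symm.toLinearMap ∘ₗ ψ.toLinearMap, ψ, ?_, fun x => ?_, fun x y => ?_⟩
  · simp [hψ, hφ1, he, LinearEquiv.symm_apply_eq]
  · rw [← hφn]
    simp [hψ, hnorm]
  · rw [hψ, hmul, hψ y]
    simp

theorem IsIsomorphicAlgebra.of_inverse {A B : Type*} [NonUnitalNonAssocRing A] [Module ℝ A]
    [NonUnitalNonAssocRing B] [Module ℝ B] (ψ : B ≃ₗ[ℝ] A)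
    (h : ∀ x y, ψ (x * y) = ψ x * ψ y) : IsIsomorphicAlgebra A B :=
  ⟨ψ.symm, fun x y => by rw [LinearEquiv.symm_apply_eq, h]; simp⟩

/-- If `F` is the half-turn about `u`, the algebra with product `F (star x) * y` is `*ℍ(i, 1)`. The
endomorphism `G` with `G i = u` and `G j = v` conjugates `F` to `x ↦ -(i * x * i)`, and right
multiplication by `-i` then removes the outer `i`. -/
theorem isIsomorphicAlgebra_starHIsotope {A : Type*} [NonUnitalNonAssocRing A] [Module ℝ A]
    {F : ℍ[ℝ] →ₐ[ℝ] ℍ[ℝ]} {ψ : ℍ[ℝ] ≃ₗ[ℝ] A} (hψ : ∀ x y, ψ (F (star x) * y) = ψ x * ψ y)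
    {u v : ℍ[ℝ]} (hu : u * u = -1) (hv : v * v = -1) (hvu : v * u = -(u * v)) (hFu : F u = u)
    (hFv : F v = -v) (hre : ∀ x, (F x).re = x.re) :
    IsIsomorphicAlgebra A (StarHIsotope quaternionI 1) := by
  obtain ⟨G, hG⟩ : ∃ G : ℍ[ℝ] →ₐ[ℝ] ℍ[ℝ],
      ∀ x, G x = x.re • 1 + x.imI • u + x.imJ • v + x.imK • (u * v) :=
    ⟨_, quaternionHom_apply hu hv hvu⟩
  have hure : u.re = 0 := Quaternion.re_eq_zero_of_anticommute hv hvu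
  have hvre : v.re = 0 := Quaternion.re_eq_zero_of_anticommute hu (by rw [hvu, neg_neg])
  have huvre : (u * v).re = 0 := by
    have := hre (u * v)
    rw [map_mul, hFu, hFv, mul_neg, Quaternion.re_neg] at this
    linarith
  have hGre (x : ℍ[ℝ]) : (G x).re = x.re := by
    rw [hG]
    simp only [Quaternion.re_add, Quaternion.re_smul, hure, hvre, huvre]
    simp
  have hFG (x : ℍ[ℝ]) : F (G x) = G (-(quaternionI * x * quaternionI)) := by
    rw [hG, hG]
    simp only [map_add, map_smul, map_mul, map_one, hFu, hFv]
    simp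
  let Θ₀ : ℍ[ℝ] →ₗ[ℝ] A :=
    ψ.toLinearMap ∘ₗ G.toLinearMap ∘ₗ LinearMap.mulRight ℝ (-quaternionI)
  have hfin : FiniteDimensional ℝ A := ψ.finiteDimensional
  have hI : quaternionI * quaternionI = -1 := by ext <;> simp
  have hI0 : -quaternionI ≠ 0 := fun h => by simp [neg_eq_zero.1 h] at hI
  have hinj : Function.Injective Θ₀ := fun x y hxy =>
    mul_right_cancel₀ hI0 (G.toRingHom.injective (ψ.injective hxy))
  obtain ⟨Θ, hΘ⟩ : ∃ Θ : ℍ[ℝ] ≃ₗ[ℝ] A, ∀ x, Θ x = ψ (G (x * -quaternionI)) :=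
    ⟨LinearEquiv.ofInjectiveOfFinrankEq Θ₀ hinj ψ.finrank_eq, fun _ => rfl⟩
  refine .of_inverse ((QuaternionIsotope.of _ _).symm.trans Θ) fun x y => ?_
  obtain ⟨x, rfl⟩ := (QuaternionIsotope.of _ _).surjective x
  obtain ⟨y, rfl⟩ := (QuaternionIsotope.of _ _).surjective y
  rw [StarHIsotope.of_mul_of]
  simp only [LinearEquiv.trans_apply, LinearEquiv.symm_apply_apply, hΘ, ← hψ]
  rw [← Quaternion.algHom_star hGre, hFG, ← map_mul]
  congr 2
  have hstar : star quaternionI = -quaternionI := by ext <;> simp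
  simp only [star_mul, star_neg, hstar, neg_neg, mul_one, ← mul_assoc, hI]
  simp [mul_assoc]

/-- Of the twisted products `f x * y`, with `f` an isometry fixing `1`, only three up to isomorphism
satisfy the condition on associators of squares: `f` must be the identity, the conjugation, or the
conjugation followed by a half-turn. -/
theorem isIsomorphicAlgebra_of_associator_sq {A : Type*} [NonUnitalNonAssocRing A] [Module ℝ A]
    {f : ℍ[ℝ] →ₗ[ℝ] ℍ[ℝ]} {ψ : ℍ[ℝ] ≃ₗ[ℝ] A} (h1 : f 1 = 1) (hf : ∀ x, ‖f x‖ = ‖x‖)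
    (hψ : ∀ x y, ψ (f x * y) = ψ x * ψ y)
    (h : ∀ x : A, associator (x * x) (x * x) (x * x) = 0) :
    IsIsomorphicAlgebra A ℍ[ℝ] ∨ IsIsomorphicAlgebra A StarH ∨
      IsIsomorphicAlgebra A (StarHIsotope quaternionI 1) := by
  have hsq (x : ℍ[ℝ]) : f (f (f x * x) * (f x * x)) = f (f x * x) * f (f x * x) := by
    rcases eq_or_ne (f x * x) 0 with h0 | h0
    · simp [h0]
    have := h (ψ x)
    rw [associator_apply, sub_eq_zero, ← hψ, ← hψ, ← hψ, ← hψ, ψ.injective.eq_iff] at this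
    exact mul_right_cancel₀ h0 (this.trans (mul_assoc _ _ _).symm)
  obtain ⟨F, hre, hF | hF⟩ := Quaternion.exists_algHom_of_norm_map h1 hf
  · have hid := Quaternion.eq_self_of_algHom_of_sq hre fun x => by simpa only [hF] using hsq x
    exact Or.inl (.of_inverse ψ fun x y => by rw [← hψ, hF, hid])
  · right
    have hinv := Quaternion.involutive_of_sq hF hsq
    by_cases hid : ∀ x, F x = x
    · refine Or.inl (.of_inverse ((QuaternionIsotope.of _ _).symm.trans ψ) fun x y => ?_)
      obtain ⟨x, rfl⟩ := (QuaternionIsotope.of _ _).surjective x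
      obtain ⟨y, rfl⟩ := (QuaternionIsotope.of _ _).surjective y
      rw [StarH.of_mul_of]
      simp [← hψ, hF, hid]
    · right
      have hFF (x : ℍ[ℝ]) : F (F x) = x := by
        simpa [hF, Quaternion.algHom_star hre] using hinv x
      obtain ⟨u, v, hu, hv, hvu, hFu, hFv⟩ :=
        Quaternion.exists_eigenvectors_of_involutive hre hFF (not_forall.1 hid)
      exact isIsomorphicAlgebra_starHIsotope (fun x y => by rw [← hF, hψ]) hu hv hvu hFu hFv hre

theorem theorem4 :
    (∀ (A : Type*) [NonUnitalNonAssocRing A] [Module ℝ A] [IsScalarTower ℝ A A]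
        [SMulCommClass ℝ A A],
      IsAbsoluteValued A →
      (∃ e : A, ∀ x : A, e * x = x) →
      Module.finrank ℝ A = 4 →
      (∀ x : A, associator (x * x) (x * x) (x * x) = 0) →
        IsIsomorphicAlgebra A ℍ[ℝ] ∨ IsIsomorphicAlgebra A StarH ∨
          IsIsomorphicAlgebra A (StarHIsotope quaternionI 1)) ∧
    HasDegree ℍ[ℝ] 2 ∧ HasDegree StarH 2 ∧ HasDegree (StarHIsotope quaternionI 1) 4 := by
  refine ⟨fun A _ _ _ _ hA he hdim h => ?_, hasDegree_quaternion, hasDegree_starH,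
    hasDegree_starHIsotope⟩
  obtain ⟨f, ψ, h1, hf, hψ⟩ := hA.exists_twisted_quaternion he hdim
  exact isIsomorphicAlgebra_of_associator_sq h1 hf hψ h
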